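/- Let $G$ be a countable discrete group acting continuously on a compact metrizable space $X$. Definitions. For finite sequences of open sets $O_1,\dots,O_n$ and $V_1,\dots,V_m$ in $X$ write $\bigsqcup_{i=1}^n O_i\times\{i\}\prec\bigsqcup_{l=1}^m V_l\times\{l\}$ if for all closed sets $F_i\subset O_i$ ($1\le i\le n$) there are, for each $i$, open sets $U^{(i)}_1,\dots,U^{(i)}_{J_i}$ covering $F_i$, elements $s^{(i)}_1,\dots,s^{(i)}_{J_i}\in G$ and indices $k^{(i)}_1,\dots,k^{(i)}_{J_i}\in\{1,\dots,m\}$ such that the sets $s^{(i)}_jU^{(i)}_j\times\{k^{(i)}_j\}$, over all pairs $(i,j)$, are pairwise disjoint subsets of $\bigsqcup_{l=1}^m V_l\times\{l\}$. Let $K(X,G)=\bigcup_{n\ge1}C(X)_+^{\oplus n}$ be the set of nonempty finite sequences of nonnegative continuous functions on $X$, and for $a=(f_1,\dots,f_n)$, $b=(g_1,\dots,g_m)\in K(X,G)$ write $a\preccurlyeq b$ if $\bigsqcup_{i}\{f_i\ne0\}\times\{i\}\prec\bigsqcup_{l}\{g_l\ne0\}\times\{l\}$. The generalized type semigroup $W(X,G)$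 is the quotient of $K(X,G)$ by the equivalence relation "$a\preccurlyeq b$ and $b\preccurlyeq a$", with addition induced by concatenation of sequences and with the partial order induced by $\preccurlyeq$. It is almost unperforated if, for all $x,y\in W(X,G)$, $(n+1)x\le ny$ for some integer $n\ge1$ implies $x\le y$. Finally, $\operatorname{Pr}_G(X)$ is the set of $G$-invariant premeasures $\mu:\mathcal A_0\to[0,\infty]$ on the algebra $\mathcal A_0$ of sets generated by the open subsets of $X$ (that is, $\mu(\emptyset)=0$ and $\mu$ is countably additive on disjoint sequences in $\mathcal A_0$ whose union lies in $\mathcal A_0$) that are regular: for every $B\in\mathcal A_0$, $\mu(B)=\sup\{\mu(F):F\subset B,\ F\text{ compact}\}=\inf\{\mu(O):B\subset O,\ O\text{ open}\}$. Theorem. The following are equivalent. (i) $W(X,G)$ is almost unperforated. (ii) For any two finite (nonempty) sequences $(A_1,\dots,A_k)$ and $(B_1,\dots,B_l)$ of open sets in $X$, if $\bigcup_{i=1}^kA_i\subset G\cdot\bigl(\bigcup_{j=1}^lB_j\bigr)$ and $\sum_{i=1}^k\mu(A_i)<\sum_{j=1}^l\mu(B_j)$ for every $\mu\in\operatorname{Pr}_G(X)$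 with $\sum_{j=1}^l\mu(B_j)=1$, then $\bigsqcup_{i=1}^kA_i\times\{i\}\prec\bigsqcup_{j=1}^lB_j\times\{j\}$. -/

import Mathlib

open scoped Pointwise NNReal ENNReal

namespace GenTypeSemigroup

section Subequivalence

variable {X G : Type*} [TopologicalSpace X] [Group G] [MulAction G X]

/-- The relation `⨆ᵢ Oᵢ × {i} ≺ ⨆ₗ Vₗ × {l}` between two finite sequences of (open) sets: for all
closed sets `F i ⊆ O i` there are finite open covers `U i 1, …, U i (J i)` of the `F i`, group
elements `s i j` and indices `k i j` such that the sets `s i j • U i j × {k i j}`, for all pairs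
`(i, j)`, are pairwise disjoint subsets of `⨆ₗ Vₗ × {l}`. -/
def Prec (G : Type*) [Group G] [MulAction G X] {n m : ℕ}
    (O : Fin n → Set X) (V : Fin m → Set X) : Prop :=
  ∀ F : Fin n → Set X, (∀ i, IsClosed (F i)) → (∀ i, F i ⊆ O i) →
    ∃ (J : Fin n → ℕ) (U : (i : Fin n) → Fin (J i) → Set X)
      (s : (i : Fin n) → Fin (J i) → G) (k : (i : Fin n) → Fin (J i) → Fin m),
      (∀ i j, IsOpen (U i j)) ∧
      (∀ i, F i ⊆ ⋃ j, U i j) ∧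
      Pairwise (fun p q : (i : Fin n) × Fin (J i) =>
        Disjoint ((s p.1 p.2 • U p.1 p.2) ×ˢ ({k p.1 p.2} : Set (Fin m)))
          ((s q.1 q.2 • U q.1 q.2) ×ˢ ({k q.1 q.2} : Set (Fin m)))) ∧
      (⋃ (i) (j), (s i j • U i j) ×ˢ ({k i j} : Set (Fin m))) ⊆
        ⋃ l, V l ×ˢ ({l} : Set (Fin m))

/-- It is enough to give the open sets as one finite family, with a map `π` to the indices `i`. -/
theorem Prec.of_family {n m : ℕ} {O : Fin n → Set X} {V : Fin m → Set X}
    (h : ∀ F : Fin n → Set X, (∀ i, IsClosed (F i)) → (∀ i, F i ⊆ O i) →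
      ∃ (J : Type) (_ : Finite J) (π : J → Fin n) (U : J → Set X) (s : J → G) (k : J → Fin m),
        (∀ j, IsOpen (U j)) ∧ (∀ i, ∀ x ∈ F i, ∃ j, π j = i ∧ x ∈ U j) ∧
        (∀ p q, p ≠ q → k p = k q → Disjoint (s p • U p) (s q • U q)) ∧
        (∀ j, s j • U j ⊆ V (k j))) : Prec G O V := by
  intro F hF hFO
  obtain ⟨J, hJ, π, U, s, k, hU, hc, hd, hs⟩ := h F hF hFO
  let e' : ∀ i, Fin (Nat.card {j // π j = i}) ≃ {j // π j = i} := fun i => (Finite.equivFin _).symm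
  refine ⟨fun i => Nat.card {j // π j = i}, fun i j => U (e' i j), fun i j => s (e' i j),
    fun i j => k (e' i j), fun i j => hU _, ?_, ?_, ?_⟩
  · intro i x hx
    obtain ⟨j, hj, hxj⟩ := hc i x hx
    refine Set.mem_iUnion.2 ⟨(e' i).symm ⟨j, hj⟩, ?_⟩
    simpa using hxj
  · rintro ⟨i, j⟩ ⟨i', j'⟩ hne
    rw [Set.disjoint_prod, Set.disjoint_singleton]
    by_cases hk : k (e' i j) = k (e' i' j')
    · refine Or.inl (hd _ _ ?_ hk)
      intro heq
      apply hne
      have hi : i = i' := by rw [← (e' i j).2, ← (e' i' j').2, heq]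
      subst hi
      exact congrArg _ ((e' i).injective (Subtype.ext heq))
    · exact Or.inr hk
  · rintro ⟨x, l⟩ hx
    simp only [Set.mem_iUnion, Set.mem_prod, Set.mem_singleton_iff] at hx ⊢
    obtain ⟨i, j, hx, rfl⟩ := hx
    exact ⟨_, hs _ hx, rfl⟩

/-- The converse passage to one finite family. -/
theorem Prec.exists_family {n m : ℕ} {O : Fin n → Set X} {V : Fin m → Set X}
    (h : Prec G O V) (F : Fin n → Set X) (hF : ∀ i, IsClosed (F i)) (hFO : ∀ i, F i ⊆ O i) :
    ∃ (J : Type) (_ : Finite J) (π : J → Fin n) (U : J → Set X) (s : J → G) (k : J → Fin m),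
      (∀ j, IsOpen (U j)) ∧ (∀ i, ∀ x ∈ F i, ∃ j, π j = i ∧ x ∈ U j) ∧
      (∀ p q, p ≠ q → k p = k q → Disjoint (s p • U p) (s q • U q)) ∧
      (∀ j, s j • U j ⊆ V (k j)) := by
  obtain ⟨J, U, s, k, hU, hc, hd, hs⟩ := h F hF hFO
  refine ⟨(i : Fin n) × Fin (J i), inferInstance, Sigma.fst, fun p => U p.1 p.2,
    fun p => s p.1 p.2, fun p => k p.1 p.2, fun p => hU _ _, ?_, ?_, ?_⟩
  · intro i x hx
    obtain ⟨j, hj⟩ := Set.mem_iUnion.1 (hc i hx)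
    exact ⟨⟨i, j⟩, rfl, hj⟩
  · intro p q hpq hk
    have := hd hpq
    beta_reduce at this
    rw [Set.disjoint_prod, Set.disjoint_singleton] at this
    exact this.resolve_right (fun h => h hk)
  · intro p x hx
    have := @hs (x, k p.1 p.2)
      (Set.mem_iUnion₂.2 ⟨p.1, p.2, hx, rfl⟩)
    simp only [Set.mem_iUnion, Set.mem_prod, Set.mem_singleton_iff] at this
    obtain ⟨l, hl, rfl⟩ := this
    exact hl

theorem Prec.of_injOn {n m : ℕ} {O : Fin n → Set X} {V : Fin m → Set X}
    (hO : ∀ i, IsOpen (O i)) (e : Fin n → Fin m)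
    (he : Set.InjOn e {i | (O i).Nonempty}) (h : ∀ i, O i ⊆ V (e i)) : Prec G O V := by
  refine Prec.of_family fun F _ hFO => ⟨{i // (O i).Nonempty}, inferInstance, Subtype.val,
    fun i => O i, fun _ => 1, fun i => e i, fun _ => hO _, ?_, ?_, ?_⟩
  · intro i x hx
    exact ⟨⟨i, x, hFO i hx⟩, rfl, hFO i hx⟩
  · intro p q hpq hk
    exact absurd (Subtype.ext (he p.2 q.2 hk)) hpq
  · intro j
    simpa using h j

theorem Prec.append {n m p q : ℕ} {O : Fin n → Set X} {V : Fin m → Set X} {O' : Fin p → Set X}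
    {V' : Fin q → Set X} (h : Prec G O V) (h' : Prec G O' V') :
    Prec G (Fin.append O O') (Fin.append V V') := by
  refine Prec.of_family fun F hF hFO => ?_
  obtain ⟨J, hJ, π, U, s, k, hU, hc, hd, hs⟩ := h.exists_family (fun i => F (Fin.castAdd p i))
    (fun i => hF _) (fun i => by simpa using hFO (Fin.castAdd p i))
  obtain ⟨J', hJ', π', U', s', k', hU', hc', hd', hs'⟩ := h'.exists_family
    (fun i => F (Fin.natAdd n i)) (fun i => hF _) (fun i => by simpa using hFO (Fin.natAdd n i))
  refine ⟨J ⊕ J', inferInstance, Sum.elim (Fin.castAdd p ∘ π) (Fin.natAdd n ∘ π'), Sum.elim U U',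
    Sum.elim s s', Sum.elim (Fin.castAdd q ∘ k) (Fin.natAdd m ∘ k'), ?_, ?_, ?_, ?_⟩
  · rintro (j | j)
    exacts [hU j, hU' j]
  · intro i
    refine Fin.addCases (fun i x hx => ?_) (fun i x hx => ?_) i
    · obtain ⟨j, rfl, hj⟩ := hc i x hx
      exact ⟨Sum.inl j, rfl, hj⟩
    · obtain ⟨j, rfl, hj⟩ := hc' i x hx
      exact ⟨Sum.inr j, rfl, hj⟩
  · rintro (a | a) (b | b) hab hk
    · exact hd a b (fun h => hab (by rw [h])) (Fin.castAdd_injective _ _ hk)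
    · exact absurd hk (by
        simp only [Sum.elim_inl, Sum.elim_inr, Function.comp_apply, Fin.ext_iff,
          Fin.val_castAdd, Fin.val_natAdd]
        omega)
    · exact absurd hk (by
        simp only [Sum.elim_inl, Sum.elim_inr, Function.comp_apply, Fin.ext_iff,
          Fin.val_castAdd, Fin.val_natAdd]
        omega)
    · exact hd' a b (fun h => hab (by rw [h])) (Fin.natAdd_injective _ _ hk)
  · rintro (j | j)
    · simpa using hs j
    · simpa using hs' j

theorem Prec.trans [CompactSpace X] [T2Space X] [ContinuousConstSMul G X] {n m p : ℕ}
    {O : Fin n → Set X} {V : Fin m → Set X} {W : Fin p → Set X}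
    (h : Prec G O V) (h' : Prec G V W) : Prec G O W := by
  refine Prec.of_family fun F hF hFO => ?_
  obtain ⟨J, hJ, π, U, s, k, hU, hc, hd, hs⟩ := h.exists_family F hF hFO
  have hsh : ∀ i, ∃ T : {j // π j = i} → Set X, F i ⊆ ⋃ j, T j ∧ (∀ j, IsOpen (T j)) ∧
      ∀ j, closure (T j) ⊆ U j := fun i =>
    exists_subset_iUnion_closure_subset (hF i) (fun j : {j // π j = i} => hU j)
      (fun x _ => Set.toFinite _) (fun x hx => by
        obtain ⟨j, hj, hxj⟩ := hc i x hx
        exact Set.mem_iUnion.2 ⟨⟨j, hj⟩, hxj⟩)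
  choose T hFT hTo hTU using hsh
  let S : J → Set X := fun j => T (π j) ⟨j, rfl⟩
  have hSU : ∀ j, closure (S j) ⊆ U j := fun j => hTU _ _
  obtain ⟨J', hJ', π', U', s', k', hU', hc', hd', hs'⟩ := h'.exists_family
    (fun l => ⋃ j : {j // k j = l}, s j • closure (S j))
    (fun l => isClosed_iUnion_of_finite fun j => isClosed_closure.smul _)
    (fun l => Set.iUnion_subset fun j => by
      obtain ⟨j, rfl⟩ := j
      exact (Set.smul_set_mono (hSU j)).trans (hs j))
  refine ⟨{r : J × J' // k r.1 = π' r.2}, inferInstance, fun r => π r.1.1,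
    fun r => S r.1.1 ∩ (s r.1.1)⁻¹ • U' r.1.2, fun r => s' r.1.2 * s r.1.1, fun r => k' r.1.2,
    ?_, ?_, ?_, ?_⟩
  · rintro ⟨⟨j, j'⟩, hr⟩
    exact (hTo _ _).inter ((hU' _).smul _)
  · intro i x hx
    obtain ⟨⟨j, rfl⟩, hj⟩ := Set.mem_iUnion.1 (hFT i hx)
    have hxS : x ∈ S j := hj
    obtain ⟨j', hj', hx'⟩ := hc' (k j) (s j • x)
      (Set.mem_iUnion.2 ⟨⟨j, rfl⟩, Set.smul_mem_smul_set (subset_closure hxS)⟩)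
    exact ⟨⟨(j, j'), hj'.symm⟩, rfl, hxS, Set.mem_inv_smul_set_iff.2 hx'⟩
  · rintro ⟨⟨a, a'⟩, ha⟩ ⟨⟨b, b'⟩, hb⟩ hab hk
    simp only at ha hb hk ⊢
    have hsub : ∀ (j : J) (j' : J'), (s' j' * s j) • (S j ∩ (s j)⁻¹ • U' j') ⊆ s' j' • U' j' := by
      intro j j'
      rw [mul_smul]
      refine Set.smul_set_mono ?_
      refine (Set.smul_set_mono Set.inter_subset_right).trans ?_
      rw [smul_inv_smul]
    have hsub' : ∀ (j : J) (j' : J'),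
        (s' j' * s j) • (S j ∩ (s j)⁻¹ • U' j') ⊆ s' j' • (s j • U j) := by
      intro j j'
      rw [mul_smul]
      exact Set.smul_set_mono (Set.smul_set_mono
        (Set.inter_subset_left.trans (subset_closure.trans (hSU j))))
    by_cases h' : a' = b'
    · subst h'
      have hne : a ≠ b := fun h => hab (by subst h; rfl)
      exact ((Set.disjoint_smul_set).2 (hd a b hne (ha.trans hb.symm))).mono
        (hsub' _ _) (hsub' _ _)
    · exact (hd' a' b' h' hk).mono (hsub _ _) (hsub _ _)
  · rintro ⟨⟨j, j'⟩, hr⟩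
    simp only
    refine Set.Subset.trans ?_ (hs' j')
    rw [mul_smul]
    refine Set.smul_set_mono ?_
    refine (Set.smul_set_mono Set.inter_subset_right).trans ?_
    rw [smul_inv_smul]

end Subequivalence

section Semigroup

variable {X G : Type*} [TopologicalSpace X]

/-- `K(X, G)`: the nonempty finite sequences of nonnegative continuous functions on `X`. -/
structure K (X G : Type*) [TopologicalSpace X] where
  /-- the length -/
  len : ℕ
  len_pos : 0 < len
  /-- the entries -/
  fn : Fin len → C(X, ℝ≥0)

/-- The open supports `{x | f i x ≠ 0}` of the entries. -/
def K.supp (a : K X G) (i : Fin a.len) : Set X := Function.support (a.fn i)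

theorem K.isOpen_supp (a : K X G) (i : Fin a.len) : IsOpen (a.supp i) :=
  isOpen_ne_fun (a.fn i).continuous continuous_const

/-- Concatenation. -/
def K.concat (a b : K X G) : K X G :=
  ⟨a.len + b.len, Nat.add_pos_left a.len_pos _, Fin.append a.fn b.fn⟩

theorem K.supp_concat (a b : K X G) : (a.concat b).supp = Fin.append a.supp b.supp := by
  funext i
  change Function.support ⇑(Fin.append (α := C(X, ℝ≥0)) a.fn b.fn i) = _
  refine Fin.addCases (fun i => ?_) (fun i => ?_) i
  · rw [Fin.append_left, Fin.append_left, K.supp]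
  · rw [Fin.append_right, Fin.append_right, K.supp]

/-- The sequence of length one with entry `0`. -/
def K.zero : K X G := ⟨1, Nat.one_pos, fun _ => 0⟩

theorem K.concat_assoc (a b c : K X G) :
    (a.concat b).concat c = a.concat (b.concat c) := by
  have key : ∀ (n m : ℕ) (hn : 0 < n) (hm : 0 < m) (h : n = m) (f : Fin n → C(X, ℝ≥0))
      (g : Fin m → C(X, ℝ≥0)), f = g ∘ Fin.cast h → (⟨n, hn, f⟩ : K X G) = ⟨m, hm, g⟩ := by
    rintro n m hn hm rfl f g rfl
    rfl
  exact key _ _ _ _ (Nat.add_assoc _ _ _) _ _ (Fin.append_assoc _ _ _)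

variable [Group G] [MulAction G X] [CompactSpace X] [T2Space X] [ContinuousConstSMul G X]

/-- `K(X, G)` with `(f₁, …, fₙ) ≼ (g₁, …, gₘ)` if `⨆ᵢ supp fᵢ × {i} ≺ ⨆ₗ supp gₗ × {l}`. -/
instance : Preorder (K X G) where
  le a b := Prec G a.supp b.supp
  le_refl a := Prec.of_injOn a.isOpen_supp id (Set.injOn_id _) fun _ => subset_rfl
  le_trans _ _ _ := Prec.trans

theorem K.le_def (a b : K X G) : a ≤ b ↔ Prec G a.supp b.supp := Iff.rfl

theorem K.concat_le_concat {a b c d : K X G} (h : a ≤ b) (h' : c ≤ d) :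
    a.concat c ≤ b.concat d := by
  rw [K.le_def, K.supp_concat, K.supp_concat]
  exact Prec.append h h'

theorem K.concat_comm_le (a b : K X G) : a.concat b ≤ b.concat a := by
  rw [K.le_def]
  refine Prec.of_injOn (K.isOpen_supp _) (finAddFlip (m := a.len) (n := b.len))
    finAddFlip.injective.injOn ?_
  rw [K.supp_concat, K.supp_concat]
  intro i
  refine Fin.addCases (fun i => ?_) (fun i => ?_) i <;> simp

theorem K.le_concat_zero (a : K X G) : a ≤ a.concat K.zero := by
  rw [K.le_def]
  refine Prec.of_injOn (K.isOpen_supp _) (Fin.castAdd 1 : Fin a.len → Fin (a.len + 1))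
    (Fin.castAdd_injective _ _).injOn ?_
  rw [K.supp_concat]
  intro i
  exact (Fin.append_left a.supp (K.zero (X := X) (G := G)).supp i).symm.subset

theorem K.concat_zero_le (a : K X G) : a.concat K.zero ≤ a := by
  have hz : ∀ i, (K.zero (X := X) (G := G)).supp i = ∅ := by
    intro i
    ext x
    simp [K.supp, K.zero]
  have ho := K.isOpen_supp (a.concat K.zero)
  rw [K.le_def]
  rw [K.supp_concat] at ho ⊢
  refine Prec.of_injOn (n := a.len + (K.zero (X := X) (G := G)).len) ho
    (Fin.addCases id fun _ => ⟨0, a.len_pos⟩) ?_ ?_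
  · intro i hi j hj h
    induction i using Fin.addCases with
    | left i =>
      induction j using Fin.addCases with
      | left j =>
        beta_reduce at h
        rw [Fin.addCases_left, Fin.addCases_left] at h
        exact congrArg _ h
      | right j =>
        rw [Set.mem_ofPred_eq, Fin.append_right, hz] at hj
        exact absurd hj Set.not_nonempty_empty
    | right i =>
      rw [Set.mem_ofPred_eq, Fin.append_right, hz] at hi
      exact absurd hi Set.not_nonempty_empty
  · intro i
    induction i using Fin.addCases with
    | left i => rw [Fin.append_left, Fin.addCases_left]; exact subset_rfl
    | right i => rw [Fin.append_right, hz]; exact Set.empty_subset _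

variable (X G) in
/-- The generalized type semigroup `W(X, G)`: the quotient of `K(X, G)` by the equivalence relation
`a ≼ b ∧ b ≼ a`, with the induced partial order. -/
def W : Type _ := Antisymmetrization (K X G) (· ≤ ·)

instance : PartialOrder (W X G) :=
  inferInstanceAs (PartialOrder (Antisymmetrization (K X G) (· ≤ ·)))

/-- The class of a sequence. -/
def W.mk (a : K X G) : W X G := toAntisymmetrization (· ≤ ·) a

theorem W.mk_le_mk {a b : K X G} : W.mk a ≤ W.mk b ↔ a ≤ b := Iff.rfl

theorem W.ind {p : W X G → Prop} (h : ∀ a, p (W.mk a)) (x : W X G) : p x :=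
  Antisymmetrization.ind _ h x

instance : Add (W X G) where
  add := Quotient.map₂ K.concat fun _ _ h _ _ h' =>
    ⟨K.concat_le_concat h.1 h'.1, K.concat_le_concat h.2 h'.2⟩

instance : Zero (W X G) := ⟨W.mk K.zero⟩

/-- Addition is induced by concatenation; the class of the zero function is neutral. -/
instance : AddCommMonoid (W X G) where
  nsmul := nsmulRec
  add_assoc x y z := by
    induction x using W.ind
    induction y using W.ind
    induction z using W.ind
    exact congrArg W.mk (K.concat_assoc _ _ _)
  add_comm x y := by
    induction x using W.ind
    induction y using W.ind
    exact le_antisymm (W.mk_le_mk.2 (K.concat_comm_le _ _)) (W.mk_le_mk.2 (K.concat_comm_le _ _))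
  zero_add x := by
    induction x using W.ind
    exact le_antisymm (W.mk_le_mk.2 ((K.concat_comm_le _ _).trans (K.concat_zero_le _)))
      (W.mk_le_mk.2 ((K.le_concat_zero _).trans (K.concat_comm_le _ _)))
  add_zero x := by
    induction x using W.ind
    exact le_antisymm (W.mk_le_mk.2 (K.concat_zero_le _)) (W.mk_le_mk.2 (K.le_concat_zero _))

theorem W.mk_add_mk (a b : K X G) : W.mk a + W.mk b = W.mk (a.concat b) := rfl

instance : IsOrderedAddMonoid (W X G) where
  add_le_add_left x y h z := by
    induction x using W.ind
    induction y using W.ind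
    induction z using W.ind
    exact W.mk_le_mk.2 (K.concat_le_concat (W.mk_le_mk.1 h) le_rfl)

end Semigroup

/-- `(n + 1) x ≤ n y` for some `n ≥ 1` implies `x ≤ y`. -/
def AlmostUnperforated (S : Type*) [AddCommMonoid S] [LE S] : Prop :=
  ∀ x y : S, (∃ n : ℕ, 0 < n ∧ (n + 1) • x ≤ n • y) → x ≤ y

/-- The algebra of sets generated by the open sets. -/
def openAlgebra (X : Type*) [TopologicalSpace X] : Set (Set X) :=
  MeasureTheory.generateSetAlgebra {U : Set X | IsOpen U}

/-- `Pr_G(X)`: the `G`-invariant regular premeasures with values in `[0, ∞]` on the algebra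
generated by the open sets. Only the values on that algebra are meaningful. -/
structure InvPremeasure (X G : Type*) [TopologicalSpace X] [Group G] [MulAction G X] where
  /-- the value on a set of the algebra -/
  val : Set X → ℝ≥0∞
  empty : val ∅ = 0
  iUnion : ∀ A : ℕ → Set X, (∀ n, A n ∈ openAlgebra X) → Pairwise (Function.onFun Disjoint A) →
    (⋃ n, A n) ∈ openAlgebra X → val (⋃ n, A n) = ∑' n, val (A n)
  invariant : ∀ g : G, ∀ B ∈ openAlgebra X, val (g • B) = val B
  innerRegular : ∀ B ∈ openAlgebra X, val B = ⨆ (F : Set X) (_ : F ⊆ B ∧ IsCompact F), val F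
  outerRegular : ∀ B ∈ openAlgebra X, val B = ⨅ (O : Set X) (_ : B ⊆ O ∧ IsOpen O), val O

end GenTypeSemigroup

/-!
Both directions compare the order of `W X G` with additive monotone functions `W X G →+ [0, ∞]`.

An invariant premeasure `μ` gives such a function, `[f₁, …, fₙ] ↦ ∑ i, μ {fᵢ ≠ 0}`: it is monotone
by inner regularity and finite additivity (`InvPremeasure.sum_le_sum_of_prec`). Hence
`(n + 1) x ≤ n y` forces `μ x ≤ n / (n + 1) < 1` whenever `μ y = 1`, and it also forces the supports
of `x` into the saturation of those of `y`. So comparison by premeasures implies almost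
unperforation.

For the converse, let `F i ⊆ A i` be closed and choose open `U i` with `F i ⊆ U i` and
`closure (U i) ⊆ A i`. By compactness `[U] ≤ m [B]` for some `m`. If `[U] ≤ [B]` fails, then almost
unperforation excludes every inequality `n [U] ≤ p [B]` with `p < n`, so the gauge of `[U]` relative
to `[B]` is at least `1`, and a Hahn–Banach argument for sublinear functions on an ordered monoid
(`IsSublinear.exists_additive`) gives an additive monotone `D` with `D [B] ≤ 1 ≤ D [U]`
(`AlmostUnperforated.exists_additive`). The regularization `O ↦ sup {D [V] : closure V ⊆ O}` of `D`
is the restriction to open sets of a Borel outer measure, which is a regular invariant premeasure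
(`invPremeasure`). The room between `U` and `A` yields `D [U] ≤ ∑ i, μ (A i)`, whereas
`∑ j, μ (B j) ≤ D [B]`. If `∑ j, μ (B j)` is positive, rescaling `D` contradicts the hypothesis on
premeasures; if it is zero, then so is `∑ i, μ (A i)`, since the `A i` lie in the saturation of the
`B j` and `G` is countable.
-/

namespace GenTypeSemigroup

/-! ### Separation by additive functions in almost unperforated monoids -/

section Sublinear

variable {M : Type*} [AddCommMonoid M] [PartialOrder M]

/-- A monotone, subadditive, `ℕ`-homogeneous real function on an ordered monoid. -/
structure IsSublinear (q : M → ℝ) : Prop where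
  mono : Monotone q
  add_le : ∀ a b, q (a + b) ≤ q a + q b
  nsmul : ∀ (n : ℕ) a, q (n • a) = n * q a

theorem IsSublinear.map_zero {q : M → ℝ} (hq : IsSublinear q) : q 0 = 0 := by
  simpa using hq.nsmul 0 0

theorem IsSublinear.nonneg {q : M → ℝ} (hq : IsSublinear q) (h0 : ∀ a : M, 0 ≤ a) (a : M) :
    0 ≤ q a :=
  hq.map_zero.symm.le.trans (hq.mono (h0 a))

/-- For sublinear `q` on a monoid with nonnegative elements, the largest function `r ≤ q` with
`r (a + w) = r a + q w` for all `a`; it is again sublinear. -/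
noncomputable def linearizeAt (q : M → ℝ) (w a : M) : ℝ :=
  ⨅ k : ℕ, (q (a + k • w) - k * q w)

/-- The gauge of `a` relative to `y`: the infimum of the fractions `p / n` with `n a ≤ p y`. -/
noncomputable def gauge (y a : M) : ℝ :=
  sInf {t : ℝ | ∃ p n : ℕ, 0 < n ∧ n • a ≤ p • y ∧ t = p / n}

theorem gauge_le {y a : M} {p n : ℕ} (hn : 0 < n) (h : n • a ≤ p • y) : gauge y a ≤ p / n := by
  refine csInf_le ⟨0, ?_⟩ ⟨p, n, hn, h, rfl⟩
  rintro _ ⟨p, n, -, -, rfl⟩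
  positivity

theorem le_gauge {y a : M} (hy : ∃ m : ℕ, a ≤ m • y) {c : ℝ}
    (h : ∀ p n : ℕ, 0 < n → n • a ≤ p • y → c ≤ p / n) : c ≤ gauge y a := by
  obtain ⟨m, hm⟩ := hy
  refine le_csInf ⟨_, m, 1, one_pos, by simpa using hm, rfl⟩ ?_
  rintro _ ⟨p, n, hn, hp, rfl⟩
  exact h p n hn hp

variable [IsOrderedAddMonoid M] {q : M → ℝ}

theorem linearizeAt_le_term (hq : IsSublinear q) (h0 : ∀ a : M, 0 ≤ a) (w a : M) (k : ℕ) :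
    linearizeAt q w a ≤ q (a + k • w) - k * q w := by
  refine ciInf_le ⟨0, ?_⟩ k
  rintro _ ⟨k, rfl⟩
  have h := hq.mono (le_add_of_nonneg_left (h0 a) : k • w ≤ a + k • w)
  rw [hq.nsmul] at h
  exact sub_nonneg.2 h

theorem linearizeAt_le (hq : IsSublinear q) (h0 : ∀ a : M, 0 ≤ a) (w a : M) :
    linearizeAt q w a ≤ q a := by
  simpa using linearizeAt_le_term hq h0 w a 0

theorem IsSublinear.linearizeAt (hq : IsSublinear q) (h0 : ∀ a : M, 0 ≤ a) (w : M) :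
    IsSublinear (linearizeAt q w) where
  mono a b hab := le_ciInf fun k => (linearizeAt_le_term hq h0 w a k).trans
    (sub_le_sub_right (hq.mono (add_le_add_left hab _)) _)
  add_le a b := by
    rw [GenTypeSemigroup.linearizeAt, GenTypeSemigroup.linearizeAt]
    refine le_ciInf_add_ciInf fun i j => ?_
    refine (linearizeAt_le_term hq h0 w _ (i + j)).trans ?_
    have h := hq.add_le (a + i • w) (b + j • w)
    rw [add_add_add_comm, ← add_nsmul] at h
    push_cast
    linarith
  nsmul n a := by
    rcases Nat.eq_zero_or_pos n with rfl | hn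
    · simp only [zero_nsmul, Nat.cast_zero, zero_mul, GenTypeSemigroup.linearizeAt, zero_add,
        hq.nsmul, sub_self, ciInf_const]
    have hn' : (0 : ℝ) < n := by exact_mod_cast hn
    apply le_antisymm
    · change GenTypeSemigroup.linearizeAt q w (n • a) ≤ n * ⨅ k : ℕ, (q (a + k • w) - k * q w)
      rw [Real.mul_iInf_of_nonneg hn'.le]
      refine le_ciInf fun k => (linearizeAt_le_term hq h0 w _ (n * k)).trans ?_
      rw [mul_nsmul', ← nsmul_add, hq.nsmul]
      push_cast
      linarith
    · refine le_ciInf fun k => ?_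
      have h1 := linearizeAt_le_term hq h0 w a k
      have h2 : q (n • a + (n * k) • w) ≤ q (n • a + k • w) + ((n - 1 : ℕ) * k : ℕ) * q w := by
        rw [← hq.nsmul]
        refine le_of_eq_of_le (congrArg q ?_) (hq.add_le _ _)
        rw [add_assoc, ← add_nsmul]
        congr 2
        obtain ⟨m, rfl⟩ : ∃ m, n = m + 1 := ⟨n - 1, by omega⟩
        simp only [Nat.add_sub_cancel]
        ring
      rw [mul_nsmul', ← nsmul_add, hq.nsmul] at h2
      have h3 := mul_le_mul_of_nonneg_left h1 hn'.le
      push_cast [Nat.cast_sub hn] at h2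
      linarith

theorem linearizeAt_add (hq : IsSublinear q) (h0 : ∀ a : M, 0 ≤ a) (w a : M) :
    linearizeAt q w (a + w) = linearizeAt q w a + q w := by
  apply le_antisymm
  · rw [← sub_le_iff_le_add]
    refine le_ciInf fun k => ?_
    rw [sub_le_iff_le_add]
    refine (linearizeAt_le_term hq h0 w _ k).trans ?_
    have h := hq.add_le (a + k • w) w
    rw [add_right_comm] at h
    linarith
  · refine le_ciInf fun k => ?_
    have h := linearizeAt_le_term hq h0 w a (k + 1)
    rw [succ_nsmul', ← add_assoc] at h
    push_cast at h
    linarith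

/-- A sublinear function dominates an additive one with the same value at a given `x`. As `M` has
no subtraction, the minimization runs over functions that are already additive in the direction
`x`; this is what keeps the value at `x` fixed. -/
theorem IsSublinear.exists_additive (hq : IsSublinear q) (h0 : ∀ a : M, 0 ≤ a) (x : M) :
    ∃ D : M →+ ℝ, Monotone D ∧ (∀ a, D a ≤ q a) ∧ D x = q x := by
  let S : Set (M → ℝ) := {r | IsSublinear r ∧ ∀ a, r (a + x) = r a + q x}
  have hS : GenTypeSemigroup.linearizeAt q x ∈ S := ⟨hq.linearizeAt h0 x, linearizeAt_add hq h0 x⟩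
  obtain ⟨m, hmq, hm⟩ := zorn_le_nonempty₀ (α := (M → ℝ)ᵒᵈ) (OrderDual.ofDual ⁻¹' S) (by
    intro c hc hchain y hy
    have hne : Nonempty c := ⟨⟨y, hy⟩⟩
    let r : M → ℝ := fun a => ⨅ s : c, OrderDual.ofDual s.1 a
    have hle : ∀ s : c, ∀ a, r a ≤ OrderDual.ofDual s.1 a := fun s a =>
      ciInf_le ⟨0, by rintro _ ⟨s, rfl⟩; exact (hc s.2).1.nonneg h0 a⟩ s
    refine ⟨OrderDual.toDual r, ⟨⟨?_, ?_, ?_⟩, ?_⟩, ?_⟩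
    · intro a b hab
      exact le_ciInf fun s => (hle s a).trans ((hc s.2).1.mono hab)
    · intro a b
      refine le_ciInf_add_ciInf fun s t => ?_
      rcases hchain.total s.2 t.2 with h | h
      · exact (hle t _).trans (((hc t.2).1.add_le a b).trans (add_le_add_left (h a) _))
      · exact (hle s _).trans (((hc s.2).1.add_le a b).trans (add_le_add_right (h b) _))
    · intro n a
      change r (n • a) = n * r a
      simp only [r]
      rw [Real.mul_iInf_of_nonneg (Nat.cast_nonneg n)]
      exact iInf_congr fun s => (hc s.2).1.nsmul n a
    · intro a
      change r (a + x) = r a + q x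
      apply le_antisymm
      · rw [← sub_le_iff_le_add]
        refine le_ciInf fun s => ?_
        rw [sub_le_iff_le_add, ← (hc s.2).2 a]
        exact hle s _
      · refine le_ciInf fun s => ?_
        rw [(hc s.2).2 a]
        exact add_le_add_left (hle s a) _
    · intro s hs a
      exact hle ⟨s, hs⟩ a) (OrderDual.toDual (GenTypeSemigroup.linearizeAt q x)) hS
  obtain ⟨⟨hms, hmx⟩, hmin⟩ := hm
  -- Linearizing a minimal element in the direction `w` leaves it unchanged.
  have hadd : ∀ a w, OrderDual.ofDual m (a + w) = OrderDual.ofDual m a + OrderDual.ofDual m w := by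
    intro a w
    have hx0 : OrderDual.ofDual m x = q x := by simpa [hms.map_zero] using hmx 0
    have hmem : GenTypeSemigroup.linearizeAt (OrderDual.ofDual m) w ∈ S := by
      refine ⟨hms.linearizeAt h0 w, fun b => ?_⟩
      have key : ∀ k : ℕ, OrderDual.ofDual m (b + x + k • w) - k * OrderDual.ofDual m w =
          OrderDual.ofDual m (b + k • w) - k * OrderDual.ofDual m w + q x := by
        intro k
        rw [add_right_comm, hmx]
        ring
      apply le_antisymm
      · rw [← sub_le_iff_le_add]
        refine le_ciInf fun k => ?_
        rw [sub_le_iff_le_add, ← key]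
        exact linearizeAt_le_term hms h0 w _ k
      · refine le_ciInf fun k => ?_
        rw [key]
        exact add_le_add_left (linearizeAt_le_term hms h0 w _ k) _
    have h1 : OrderDual.ofDual m a ≤ _ :=
      (hmin (y := OrderDual.toDual (GenTypeSemigroup.linearizeAt (OrderDual.ofDual m) w)) hmem
        (linearizeAt_le hms h0 w) a).trans (linearizeAt_le_term hms h0 w a 1)
    rw [one_nsmul, Nat.cast_one, one_mul] at h1
    exact le_antisymm (hms.add_le a w) (by linarith)
  refine ⟨⟨⟨OrderDual.ofDual m, hms.map_zero⟩, hadd⟩, hms.mono,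
    fun a => (hmq a).trans (linearizeAt_le hq h0 x a), ?_⟩
  change OrderDual.ofDual m x = q x
  simpa [hms.map_zero] using hmx 0

theorem isSublinear_gauge (y : M) (hy : ∀ a : M, ∃ m : ℕ, a ≤ m • y) :
    IsSublinear (gauge y) where
  mono a b hab := le_gauge (hy b) fun p n hn h => gauge_le hn ((nsmul_le_nsmul_right hab n).trans h)
  add_le a b := by
    rw [← sub_le_iff_le_add]
    refine le_gauge (hy a) fun p n hn h => ?_
    rw [sub_le_iff_le_add, ← sub_le_iff_le_add']
    refine le_gauge (hy b) fun p' n' hn' h' => ?_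
    rw [sub_le_iff_le_add']
    have h1 : (n * n') • (a + b) ≤ (p * n' + p' * n) • y := by
      rw [nsmul_add, add_nsmul]
      refine add_le_add ?_ ?_
      · rw [mul_comm n, mul_comm p, mul_nsmul', mul_nsmul']
        exact nsmul_le_nsmul_right h _
      · rw [mul_comm p', mul_nsmul', mul_nsmul']
        exact nsmul_le_nsmul_right h' _
    refine (gauge_le (Nat.mul_pos hn hn') h1).trans_eq ?_
    have : (n : ℝ) ≠ 0 := by positivity
    have : (n' : ℝ) ≠ 0 := by positivity
    push_cast
    field_simp
  nsmul k a := by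
    rcases Nat.eq_zero_or_pos k with rfl | hk
    · rw [zero_nsmul, Nat.cast_zero, zero_mul]
      refine le_antisymm ?_ (le_gauge (hy 0) fun p n _ _ => by positivity)
      simpa using gauge_le (y := y) (a := 0) (p := 0) (n := 1) one_pos (by simp)
    have hk' : (0 : ℝ) < k := by positivity
    apply le_antisymm
    · rw [← div_le_iff₀' hk']
      refine le_gauge (hy a) fun p n hn h => ?_
      rw [div_le_iff₀' hk']
      refine (gauge_le (p := k * p) hn ?_).trans_eq (by push_cast; ring)
      rw [← mul_nsmul', mul_comm, mul_nsmul', mul_nsmul']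
      exact nsmul_le_nsmul_right h _
    · refine le_gauge (hy _) fun p n hn h => ?_
      rw [← le_div_iff₀' hk']
      rw [← mul_nsmul'] at h
      refine (gauge_le (Nat.mul_pos hn hk) h).trans_eq ?_
      push_cast
      rw [div_div]

/-- If no inequality `n x ≤ p y` with `p < n` holds and `y` is an order unit, then the gauge of
`x` is at least `1`, and an additive function below the gauge separates `x` from `y`. -/
theorem exists_additive_of_orderUnit (h0 : ∀ a : M, 0 ≤ a) (x y : M)
    (hy : ∀ a : M, ∃ m : ℕ, a ≤ m • y) (hxy : ∀ p n : ℕ, p < n → ¬ n • x ≤ p • y) :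
    ∃ D : M →+ ℝ, Monotone D ∧ D y ≤ 1 ∧ 1 ≤ D x := by
  obtain ⟨D, hD, hDq, hDx⟩ := (isSublinear_gauge y hy).exists_additive h0 x
  refine ⟨D, hD, (hDq y).trans ?_, hDx ▸ le_gauge (hy x) fun p n hn h => ?_⟩
  · simpa using gauge_le (y := y) (a := y) (p := 1) (n := 1) one_pos le_rfl
  · rw [one_le_div (by positivity)]
    exact_mod_cast not_lt.1 fun hlt => hxy p n hlt h

/-- In an almost unperforated positively ordered monoid, `x ≤ m y` and `x ≰ y` are told apart by an
additive monotone function with values in `[0, ∞]`. The one built here is infinite outside the order ideal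
generated by `y`. -/
theorem AlmostUnperforated.exists_additive (hM : AlmostUnperforated M) (h0 : ∀ a : M, 0 ≤ a)
    {x y : M} {m : ℕ} (hm : x ≤ m • y) (hxy : ¬ x ≤ y) :
    ∃ D : M →+ ℝ≥0∞, Monotone D ∧ D y ≤ 1 ∧ 1 ≤ D x := by
  classical
  let S : AddSubmonoid M :=
    { carrier := {a | ∃ k : ℕ, a ≤ k • y}
      zero_mem' := ⟨0, by simp⟩
      add_mem' := by
        rintro a b ⟨k, hk⟩ ⟨l, hl⟩
        exact ⟨k + l, by rw [add_nsmul]; exact add_le_add hk hl⟩ }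
  have hle : ∀ {a b : M}, a ≤ b → b ∈ S → a ∈ S := fun hab ⟨k, hk⟩ => ⟨k, hab.trans hk⟩
  have hyS : y ∈ S := ⟨1, by simp⟩
  have hxS : x ∈ S := ⟨m, hm⟩
  have hxy' : ∀ p n : ℕ, p < n → ¬ n • x ≤ p • y := by
    intro p n hpn h
    apply hxy
    rcases Nat.eq_zero_or_pos p with rfl | hp
    · refine le_trans ?_ (h0 y)
      refine le_trans ?_ (h.trans_eq (zero_nsmul y))
      exact (one_nsmul x).symm.le.trans (nsmul_le_nsmul_left (h0 x) hpn)
    · exact hM x y ⟨p, hp, (nsmul_le_nsmul_left (h0 x) hpn).trans h⟩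
  obtain ⟨D, hD, hDy, hDx⟩ := exists_additive_of_orderUnit (M := S) (fun a => h0 a) ⟨x, hxS⟩
    ⟨y, hyS⟩ (fun a => a.2) (fun p n hpn h => hxy' p n hpn h)
  have hD0 : ∀ a, 0 ≤ D a := fun a => D.map_zero.symm.le.trans (hD (h0 a))
  let E : M → ℝ≥0∞ := fun a => if h : a ∈ S then ENNReal.ofReal (D ⟨a, h⟩) else ⊤
  have hE : ∀ a (h : a ∈ S), E a = ENNReal.ofReal (D ⟨a, h⟩) := fun a h => dif_pos h
  have hE' : ∀ a, a ∉ S → E a = ⊤ := fun a h => dif_neg h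
  refine ⟨⟨⟨E, ?_⟩, ?_⟩, ?_, ?_, ?_⟩
  · rw [hE 0 S.zero_mem]
    exact (congrArg ENNReal.ofReal D.map_zero).trans ENNReal.ofReal_zero
  · intro a b
    change E (a + b) = E a + E b
    by_cases ha : a ∈ S
    · by_cases hb : b ∈ S
      · rw [hE a ha, hE b hb, hE _ (S.add_mem ha hb), ← ENNReal.ofReal_add (hD0 _) (hD0 _),
          ← D.map_add]
        rfl
      · rw [hE' b hb, hE' _ fun h => hb (hle (le_add_of_nonneg_left (h0 a)) h), add_top]
    · rw [hE' a ha, hE' _ fun h => ha (hle (le_add_of_nonneg_right (h0 b)) h), top_add]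
  · intro a b hab
    change E a ≤ E b
    by_cases hb : b ∈ S
    · rw [hE b hb, hE a (hle hab hb)]
      exact ENNReal.ofReal_le_ofReal (hD hab)
    · rw [hE' b hb]
      exact le_top
  · change E y ≤ 1
    rw [hE y hyS]
    exact ENNReal.ofReal_le_one.2 hDy
  · change 1 ≤ E x
    rw [hE x hxS]
    exact ENNReal.one_le_ofReal.2 hDx

end Sublinear

/-! ### Classes of open sets -/

section Classes

variable {X G : Type*} [TopologicalSpace X]

/-- In a metrizable space every open set is the support of a nonnegative continuous function. -/
theorem exists_support_eq [TopologicalSpace.MetrizableSpace X] {O : Set X} (hO : IsOpen O) :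
    ∃ f : C(X, ℝ≥0), Function.support f = O := by
  let _ := TopologicalSpace.metrizableSpaceMetric X
  -- The distance to the empty set is `0` by convention, so `O = univ` is treated separately.
  rcases Set.eq_empty_or_nonempty Oᶜ with h | h
  · refine ⟨1, ?_⟩
    rw [Set.compl_empty_iff.1 h]
    ext x
    simp
  · refine ⟨⟨fun x => Metric.infNndist x Oᶜ, Metric.continuous_infNndist_pt _⟩, ?_⟩
    ext x
    have := hO.isClosed_compl.notMem_iff_infDist_pos h (x := x)
    rw [Set.notMem_compl_iff] at this
    rw [this, Function.mem_support, ContinuousMap.coe_mk, ← Metric.coe_infNndist, NNReal.coe_pos,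
      pos_iff_ne_zero]

theorem supp_exists_support_eq [TopologicalSpace.MetrizableSpace X] (O : TopologicalSpace.Opens X)
    (i : Fin 1) :
    K.supp (⟨1, one_pos, fun _ => (exists_support_eq O.isOpen).choose⟩ : K X G) i = O :=
  (exists_support_eq O.isOpen).choose_spec

variable [CompactSpace X] [T2Space X] [Group G] [MulAction G X] [ContinuousConstSMul G X]

theorem W.mk_eq_mk_of_supp {a b : K X G} (h : a.len = b.len)
    (hs : ∀ i, a.supp i = b.supp (Fin.cast h i)) : W.mk a = W.mk b := by
  refine le_antisymm (W.mk_le_mk.2 ?_) (W.mk_le_mk.2 ?_)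
  · exact Prec.of_injOn a.isOpen_supp (Fin.cast h) (Fin.cast_injective h).injOn fun i => (hs i).subset
  · refine Prec.of_injOn b.isOpen_supp (Fin.cast h.symm) (Fin.cast_injective _).injOn fun i => ?_
    rw [hs]
    exact subset_rfl

theorem W.nonneg (w : W X G) : 0 ≤ w := by
  induction w using W.ind with
  | h a =>
    refine W.mk_le_mk.2 (Prec.of_injOn (K.isOpen_supp _) (fun _ => ⟨0, a.len_pos⟩) ?_ fun i => ?_)
    · rintro i ⟨x, hx⟩
      exact absurd rfl hx
    · intro x hx
      exact absurd rfl hx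

variable [TopologicalSpace.MetrizableSpace X]

variable (G) in
/-- The class in `W X G` of the one-term sequence with open support `O`. The function with that
support is chosen arbitrarily; the class does not depend on it. -/
noncomputable def openClass (O : TopologicalSpace.Opens X) : W X G :=
  W.mk ⟨1, one_pos, fun _ => (exists_support_eq O.isOpen).choose⟩

/-- The class of a sequence is the sum of the classes of its open supports. -/
theorem W.mk_eq_sum (a : K X G) :
    W.mk a = ∑ i, openClass G ⟨a.supp i, a.isOpen_supp i⟩ := by
  obtain ⟨n, hn, f⟩ := a
  induction n, hn using Nat.le_induction with
  | base =>
    rw [Fin.sum_univ_one]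
    refine W.mk_eq_mk_of_supp rfl fun i => ?_
    rw [supp_exists_support_eq]
    exact congrArg _ (Subsingleton.elim _ _)
  | succ n hn ih =>
    rw [Fin.sum_univ_castSucc]
    have h := ih (fun i => f i.castSucc)
    refine Eq.trans ?_ (congrArg₂ (· + ·) h rfl)
    let a : K X G := ⟨n + 1, n.succ_pos, f⟩
    refine (W.mk_eq_mk_of_supp (a := a) (b := K.concat ⟨n, hn, fun i => f i.castSucc⟩
      ⟨1, one_pos, fun _ => (exists_support_eq (a.isOpen_supp (Fin.last n))).choose⟩)
      rfl fun i => ?_).trans (W.mk_add_mk _ _).symm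
    rw [K.supp_concat]
    induction i using Fin.lastCases with
    | cast i =>
      refine Eq.trans ?_ (Fin.append_left _ _ i).symm
      rfl
    | last =>
      refine Eq.trans ?_ (Fin.append_right _ _ (0 : Fin 1)).symm
      exact (supp_exists_support_eq ⟨a.supp (Fin.last n), a.isOpen_supp _⟩ 0).symm

theorem openClass_le_sum {ι : Type*} [Fintype ι] {O : TopologicalSpace.Opens X}
    {V : ι → TopologicalSpace.Opens X} {s : ι → G} (h : (O : Set X) ⊆ ⋃ i, s i • (V i : Set X)) :
    openClass G O ≤ ∑ i, openClass G (V i) := by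
  rcases isEmpty_or_nonempty ι with hι | hι
  · rw [Finset.univ_eq_empty, Finset.sum_empty]
    refine W.mk_le_mk.2 (Prec.of_injOn (K.isOpen_supp _) (fun _ => ⟨0, one_pos⟩)
      (fun _ _ _ _ _ => Subsingleton.elim (α := Fin 1) _ _) fun i => ?_)
    rw [supp_exists_support_eq]
    refine h.trans ?_
    rw [Set.iUnion_of_empty]
    exact Set.empty_subset _
  let e : Fin (Fintype.card ι) ≃ ι := (Fintype.equivFin ι).symm
  let b : K X G := ⟨Fintype.card ι, Fintype.card_pos,
    fun i => (exists_support_eq (V (e i)).isOpen).choose⟩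
  have hb : ∀ i, b.supp i = V (e i) := fun i => (exists_support_eq (V (e i)).isOpen).choose_spec
  have hsum : W.mk b = ∑ i, openClass G (V i) := by
    rw [W.mk_eq_sum, ← e.sum_comp fun i => openClass G (V i)]
    exact Finset.sum_congr rfl fun i _ => congrArg (openClass G) (TopologicalSpace.Opens.ext (hb i))
  rw [← hsum]
  refine W.mk_le_mk.2 (Prec.of_family fun F _ hFO => ⟨Fin (Fintype.card ι), inferInstance,
    fun _ => ⟨0, one_pos⟩, fun i => s (e i) • (V (e i) : Set X), fun i => (s (e i))⁻¹, id, ?_, ?_,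
    ?_, ?_⟩)
  · exact fun j => (V (e j)).isOpen.smul _
  · intro i x hx
    have hx' : x ∈ (O : Set X) := by
      rw [← supp_exists_support_eq (G := G) O i]
      exact hFO i hx
    obtain ⟨j, hj⟩ := Set.mem_iUnion.1 (h hx')
    exact ⟨e.symm j, Subsingleton.elim (α := Fin 1) _ _, by simpa using hj⟩
  · exact fun p q hpq hk => absurd hk hpq
  · intro j
    rw [inv_smul_smul]
    exact (hb j).symm.subset

theorem openClass_mono {O V : TopologicalSpace.Opens X} (h : O ≤ V) :
    openClass G O ≤ openClass G V := by
  simpa using openClass_le_sum (G := G) (ι := Unit) (V := fun _ => V) (s := fun _ => 1)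
    (by simpa [Set.iUnion_const] using h)

theorem openClass_le_of_subset_smul {O V : TopologicalSpace.Opens X} (g : G)
    (h : (O : Set X) ⊆ g • (V : Set X)) : openClass G O ≤ openClass G V := by
  simpa using openClass_le_sum (G := G) (ι := Unit) (V := fun _ => V) (s := fun _ => g)
    (by simpa [Set.iUnion_const] using h)

theorem openClass_bot : openClass G (⊥ : TopologicalSpace.Opens X) = 0 := by
  refine le_antisymm ?_ (W.nonneg _)
  simpa using openClass_le_sum (G := G) (ι := Empty) (O := (⊥ : TopologicalSpace.Opens X))
    (V := fun _ => ⊥) (s := fun _ => 1) (by simp)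

theorem openClass_add_le {U V : TopologicalSpace.Opens X} (h : Disjoint (U : Set X) V) :
    openClass G U + openClass G V ≤ openClass G (U ⊔ V) := by
  have hsupp : ∀ i, K.supp (K.concat
      (⟨1, one_pos, fun _ => (exists_support_eq U.isOpen).choose⟩ : K X G)
      ⟨1, one_pos, fun _ => (exists_support_eq V.isOpen).choose⟩) i = ![(U : Set X), V] i := by
    rw [K.supp_concat]
    intro i
    fin_cases i
    · exact (Fin.append_left _ _ (0 : Fin 1)).trans (supp_exists_support_eq U 0)
    · exact (Fin.append_right _ _ (0 : Fin 1)).trans (supp_exists_support_eq V 0)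
  refine W.mk_le_mk.2 (Prec.of_family fun F _ hFO => ⟨Fin 2, inferInstance, id,
    ![(U : Set X), V], fun _ => 1, fun _ => ⟨0, one_pos⟩, ?_, ?_, ?_, ?_⟩)
  · intro j
    fin_cases j
    exacts [U.isOpen, V.isOpen]
  · intro i x hx
    exact ⟨i, rfl, by rw [← hsupp]; exact hFO i hx⟩
  · intro p q hpq _
    rw [one_smul, one_smul]
    fin_cases p <;> fin_cases q
    exacts [absurd rfl hpq, h, h.symm, absurd rfl hpq]
  · intro j
    rw [one_smul, supp_exists_support_eq]
    fin_cases j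
    exacts [Set.subset_union_left, Set.subset_union_right]

end Classes

/-! ### Regularization of an additive function to a premeasure -/

section Regularization

open TopologicalSpace MeasureTheory

variable {X G : Type*} [TopologicalSpace X] [CompactSpace X] [MetrizableSpace X] [Group G]
  [MulAction G X] [ContinuousConstSMul G X]

/-- The regularization of an additive function `D` on `W X G`: its value on `O` is the supremum of
`D` over the open sets whose closure lies in `O`. -/
noncomputable def regularization (D : W X G →+ ℝ≥0∞) (O : Set X) : ℝ≥0∞ :=
  ⨆ U : {U : Opens X // closure (U : Set X) ⊆ O}, D (openClass G U)

instance (O : Set X) : Nonempty {U : Opens X // closure (U : Set X) ⊆ O} :=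
  ⟨⟨⊥, by simp⟩⟩

variable {D : W X G →+ ℝ≥0∞}

theorem le_regularization {U : Opens X} {O : Set X} (h : closure (U : Set X) ⊆ O) :
    D (openClass G U) ≤ regularization D O :=
  le_iSup (fun U : {U : Opens X // closure (U : Set X) ⊆ O} => D (openClass G U)) ⟨U, h⟩

theorem regularization_mono {O V : Set X} (h : O ⊆ V) : regularization D O ≤ regularization D V :=
  iSup_le fun U => le_regularization (U.2.trans h)

theorem regularization_le (hD : Monotone D) (O : Opens X) :
    regularization D O ≤ D (openClass G O) :=
  iSup_le fun U => hD (openClass_mono (subset_closure.trans U.2))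

theorem regularization_empty : regularization D ∅ = 0 := by
  refine le_antisymm (iSup_le fun U => ?_) zero_le
  have : U.1 = ⊥ := Opens.ext (Set.subset_eq_empty (subset_closure.trans U.2) rfl)
  rw [this, openClass_bot, map_zero]

theorem regularization_iUnion_le (hD : Monotone D) {O : ℕ → Set X} (hO : ∀ n, IsOpen (O n)) :
    regularization D (⋃ n, O n) ≤ ∑' n, regularization D (O n) := by
  refine iSup_le fun ⟨U, hU⟩ => ?_
  obtain ⟨t, ht⟩ := isClosed_closure.isCompact.elim_finite_subcover O hO hU
  obtain ⟨v, hv, hvo, hvc⟩ := exists_subset_iUnion_closure_subset (u := fun i : t => O i)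
    (isClosed_closure (s := (U : Set X))) (fun i => hO i) (fun x _ => Set.toFinite _)
    (ht.trans (Set.iUnion_subtype (· ∈ t) fun i => O i).symm.subset)
  have h := hD (openClass_le_sum (G := G) (O := U) (V := fun i : t => ⟨v i, hvo i⟩)
    (s := fun _ => 1) (by simpa using subset_closure.trans hv))
  rw [map_sum] at h
  calc D (openClass G U) ≤ ∑ i : t, regularization D (O i) :=
        h.trans (Finset.sum_le_sum fun i _ => le_regularization (hvc i))
    _ = ∑ i ∈ t, regularization D (O i) := Finset.sum_coe_sort t fun i => regularization D (O i)
    _ ≤ _ := ENNReal.sum_le_tsum t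

theorem regularization_smul_le (hD : Monotone D) (g : G) (O : Set X) :
    regularization D (g • O) ≤ regularization D O := by
  refine iSup_le fun ⟨U, hU⟩ => ?_
  let V : Opens X := ⟨g⁻¹ • (U : Set X), U.isOpen.smul _⟩
  refine (hD (openClass_le_of_subset_smul (V := V) g ?_)).trans (le_regularization ?_)
  · simp [V]
  · change closure (g⁻¹ • (U : Set X)) ⊆ O
    rw [closure_smul]
    exact Set.smul_set_subset_iff_subset_inv_smul_set.2 (by rwa [inv_inv])

theorem regularization_smul (hD : Monotone D) (g : G) (O : Set X) :
    regularization D (g • O) = regularization D O := by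
  refine le_antisymm (regularization_smul_le hD g O) ?_
  simpa using regularization_smul_le hD g⁻¹ (g • O)

theorem add_regularization_sdiff_le (hD : Monotone D) {V : Opens X} {O : Set X}
    (hV : closure (V : Set X) ⊆ O) :
    D (openClass G V) + regularization D (O \ closure V) ≤ regularization D O := by
  rw [regularization, ENNReal.add_iSup]
  refine iSup_le fun ⟨U, hU⟩ => ?_
  rw [← map_add]
  refine (hD (openClass_add_le ?_)).trans (le_regularization ?_)
  · exact Set.disjoint_left.2 fun x hx hx' => (hU (subset_closure hx')).2 (subset_closure hx)
  · rw [Opens.coe_sup, closure_union]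
    exact Set.union_subset hV (hU.trans Set.sdiff_subset)

/-- The outer measure with value `regularization D O` on each open set `O`. -/
noncomputable def outerMeasure (D : W X G →+ ℝ≥0∞) : OuterMeasure X :=
  inducedOuterMeasure (P := IsOpen) (fun O _ => regularization D O) isOpen_empty
    regularization_empty

theorem outerMeasure_eq_iInf (hD : Monotone D) (s : Set X) :
    outerMeasure D s = ⨅ (O : Set X) (_ : IsOpen O) (_ : s ⊆ O), regularization D O :=
  inducedOuterMeasure_eq_iInf (fun _ h => isOpen_iUnion h)
    (fun _ h => regularization_iUnion_le hD h) (fun _ _ _ _ h => regularization_mono h) s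

theorem outerMeasure_of_isOpen (hD : Monotone D) {O : Set X} (hO : IsOpen O) :
    outerMeasure D O = regularization D O :=
  inducedOuterMeasure_eq' (fun _ h => isOpen_iUnion h)
    (fun _ h => regularization_iUnion_le hD h) (fun _ _ _ _ h => regularization_mono h) hO

theorem outerMeasure_smul (hD : Monotone D) (g : G) (s : Set X) :
    outerMeasure D (g • s) = outerMeasure D s := by
  rw [← inv_inv g, ← Set.preimage_smul]
  exact inducedOuterMeasure_preimage (fun _ h => isOpen_iUnion h)
    (fun _ h => regularization_iUnion_le hD h) (fun _ _ _ _ h => regularization_mono h)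
    (MulAction.toPerm g⁻¹) (fun s => (Homeomorph.smul g⁻¹).isOpen_preimage)
    (fun s _ => by
      change regularization D ((fun x => g⁻¹ • x) ⁻¹' s) = _
      rw [Set.preimage_smul, regularization_smul hD])

theorem borel_le_caratheodory (hD : Monotone D) : borel X ≤ (outerMeasure D).caratheodory := by
  refine MeasurableSpace.generateFrom_le fun U hU => ?_
  refine (inducedOuterMeasure_caratheodory (fun _ h => isOpen_iUnion h)
    (fun _ h => regularization_iUnion_le hD h) (fun _ _ _ _ h => regularization_mono h) U).2 ?_
  intro t ht
  change outerMeasure D (t ∩ U) + outerMeasure D (t \ U) ≤ outerMeasure D t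
  rw [outerMeasure_of_isOpen hD (ht.inter hU), outerMeasure_of_isOpen hD ht, regularization,
    ENNReal.iSup_add]
  refine iSup_le fun ⟨V, hV⟩ => ?_
  refine (add_le_add_right ?_ _).trans
    (add_regularization_sdiff_le hD (hV.trans Set.inter_subset_left))
  rw [← outerMeasure_of_isOpen hD (ht.sdiff isClosed_closure)]
  exact measure_mono (Set.sdiff_subset_sdiff_right (hV.trans Set.inter_subset_right))

omit [CompactSpace X] in
/-- Sets of the algebra generated by the open sets are both `Gδ` and `Fσ`. -/
theorem isGδ_of_mem_openAlgebra {B : Set X} (hB : B ∈ openAlgebra X) : IsGδ B ∧ IsGδ Bᶜ := by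
  let _ := metrizableSpaceMetric X
  induction hB with
  | base s hs => exact ⟨hs.isGδ, hs.isClosed_compl.isGδ⟩
  | empty => exact ⟨.empty, by simp⟩
  | compl s _ ih => exact ⟨ih.2, by rw [compl_compl]; exact ih.1⟩
  | union s t _ _ hs ht =>
    exact ⟨hs.1.union ht.1, by rw [Set.compl_union]; exact hs.2.inter ht.2⟩

omit [CompactSpace X] in
theorem measurableSet_of_mem_openAlgebra [MeasurableSpace X] [BorelSpace X] {B : Set X}
    (hB : B ∈ openAlgebra X) : MeasurableSet B :=
  (isGδ_of_mem_openAlgebra hB).1.measurableSet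

/-- A set of the algebra is `Fσ`, hence `σ`-compact, and continuity from below gives inner
regularity, also where the measure is infinite. -/
theorem outerMeasure_eq_iSup_isCompact (hD : Monotone D) {B : Set X} (hB : B ∈ openAlgebra X) :
    outerMeasure D B = ⨆ (F : Set X) (_ : F ⊆ B ∧ IsCompact F), outerMeasure D F := by
  refine le_antisymm ?_ (iSup₂_le fun F hF => measure_mono hF.1)
  borelize X
  obtain ⟨f, hf, hBf⟩ := isGδ_iff_eq_iInter_nat.1 (isGδ_of_mem_openAlgebra hB).2
  have hc : ∀ n, IsClosed (f n)ᶜ := fun n => (hf n).isClosed_compl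
  have hBf' : B = ⋃ n, (f n)ᶜ := by rw [← Set.compl_iInter, ← hBf, compl_compl]
  have hacc : ∀ n, IsClosed (Set.accumulate (fun n => (f n)ᶜ) n) := fun n =>
    (Set.finite_Iic n).isClosed_biUnion fun i _ => hc i
  let m := (outerMeasure D).toMeasure (borel_le_caratheodory hD)
  have hm : ∀ s, MeasurableSet s → m s = outerMeasure D s := fun s hs => toMeasure_apply _ _ hs
  rw [← hm B (measurableSet_of_mem_openAlgebra hB)]
  nth_rw 1 [hBf']
  rw [measure_iUnion_eq_iSup_accumulate]
  refine iSup_le fun n => ?_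
  rw [hm _ (hacc n).measurableSet]
  refine le_iSup₂_of_le (Set.accumulate (fun n => (f n)ᶜ) n) ⟨?_, (hacc n).isCompact⟩ le_rfl
  rw [hBf']
  exact Set.accumulate_subset_iUnion n

/-- The invariant regular premeasure attached to an additive monotone function on `W X G`. -/
noncomputable def invPremeasure (hD : Monotone D) : InvPremeasure X G where
  val := outerMeasure D
  empty := measure_empty
  iUnion A hA hd _ := by
    borelize X
    exact OuterMeasure.iUnion_eq_of_caratheodory _
      (fun n => borel_le_caratheodory hD _ (measurableSet_of_mem_openAlgebra (hA n))) hd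
  invariant g B _ := outerMeasure_smul hD g B
  innerRegular B hB := outerMeasure_eq_iSup_isCompact hD hB
  outerRegular B _ := by
    refine le_antisymm (le_iInf₂ fun O hO => measure_mono hO.1) ?_
    rw [outerMeasure_eq_iInf hD]
    exact le_iInf₂ fun O hO => le_iInf fun h =>
      iInf₂_le_of_le O ⟨h, hO⟩ (outerMeasure_of_isOpen hD hO).le

theorem invPremeasure_val_of_isOpen (hD : Monotone D) {O : Set X} (hO : IsOpen O) :
    (invPremeasure hD).val O = regularization D O :=
  outerMeasure_of_isOpen hD hO

end Regularization

/-! ### Functions on the semigroup defined by premeasures and by saturations -/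

section Functional

open TopologicalSpace MeasureTheory

variable {X G : Type*} [TopologicalSpace X]

theorem K.iUnion_supp_concat (a b : K X G) :
    ⋃ i, (a.concat b).supp i = (⋃ i, a.supp i) ∪ ⋃ i, b.supp i := by
  ext x
  simp only [Set.mem_iUnion, Set.mem_union]
  rw [K.supp_concat]
  constructor
  · rintro ⟨i, hi⟩
    induction i using Fin.addCases with
    | left i => exact Or.inl ⟨i, by rwa [Fin.append_left] at hi⟩
    | right i => exact Or.inr ⟨i, by rwa [Fin.append_right] at hi⟩
  · rintro (⟨i, hi⟩ | ⟨i, hi⟩)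
    · exact ⟨Fin.castAdd _ i, by rwa [Fin.append_left]⟩
    · exact ⟨Fin.natAdd _ i, by rwa [Fin.append_right]⟩

variable [Group G] [MulAction G X]

theorem isSetAlgebra_openAlgebra : IsSetAlgebra (openAlgebra X) :=
  isSetAlgebra_generateSetAlgebra

theorem mem_openAlgebra_of_isOpen {O : Set X} (hO : IsOpen O) : O ∈ openAlgebra X :=
  self_subset_generateSetAlgebra hO

theorem mem_openAlgebra_of_isClosed {F : Set X} (hF : IsClosed F) : F ∈ openAlgebra X := by
  simpa using isSetAlgebra_openAlgebra.compl_mem (mem_openAlgebra_of_isOpen hF.isOpen_compl)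

namespace InvPremeasure

variable (μ : InvPremeasure X G)

theorem val_union {A B : Set X} (hA : A ∈ openAlgebra X) (hB : B ∈ openAlgebra X)
    (h : Disjoint A B) : μ.val (A ∪ B) = μ.val A + μ.val B := by
  let f : ℕ → Set X := fun n => if n = 0 then A else if n = 1 then B else ∅
  have hU : ⋃ n, f n = A ∪ B := by
    ext x
    simp only [Set.mem_iUnion, Set.mem_union]
    constructor
    · rintro ⟨n, hn⟩
      simp only [f] at hn
      split_ifs at hn
      exacts [Or.inl hn, Or.inr hn, hn.elim]
    · rintro (hx | hx)
      exacts [⟨0, hx⟩, ⟨1, hx⟩]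
  have hd : Pairwise (Function.onFun Disjoint f) := by
    intro m n hmn
    simp only [Function.onFun, f]
    split_ifs
    all_goals first
      | exact h
      | exact h.symm
      | exact Set.disjoint_empty _
      | exact Set.empty_disjoint _
      | omega
  rw [← hU, μ.iUnion f _ hd (hU ▸ isSetAlgebra_openAlgebra.union_mem hA hB),
    tsum_eq_sum (s := Finset.range 2)]
  · simp [Finset.sum_range_succ, f]
  · intro n hn
    simp only [Finset.mem_range] at hn
    simp only [f]
    rw [if_neg (by omega), if_neg (by omega), μ.empty]
  · intro n
    simp only [f]
    split_ifs
    exacts [hA, hB, isSetAlgebra_openAlgebra.empty_mem]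

/-- A premeasure as an additive content on the algebra generated by the open sets. -/
noncomputable def content : AddContent ℝ≥0∞ (openAlgebra X) :=
  isSetAlgebra_openAlgebra.isSetRing.addContent_of_union μ.val μ.empty
    fun hA hB h => μ.val_union hA hB h

theorem val_mono {A B : Set X} (hA : A ∈ openAlgebra X) (hB : B ∈ openAlgebra X) (h : A ⊆ B) :
    μ.val A ≤ μ.val B :=
  addContent_mono (m := μ.content) isSetAlgebra_openAlgebra.isSetRing.isSetSemiring hA hB h

theorem val_biUnion_le {ι : Type*} (s : Finset ι) {f : ι → Set X}
    (hf : ∀ i, f i ∈ openAlgebra X) : μ.val (⋃ i ∈ s, f i) ≤ ∑ i ∈ s, μ.val (f i) :=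
  addContent_biUnion_le (m := μ.content) isSetAlgebra_openAlgebra.isSetRing fun i _ => hf i

theorem val_biUnion_eq {ι : Type*} (s : Finset ι) {f : ι → Set X}
    (hf : ∀ i, f i ∈ openAlgebra X) (hd : (s : Set ι).PairwiseDisjoint f) :
    μ.val (⋃ i ∈ s, f i) = ∑ i ∈ s, μ.val (f i) :=
  addContent_biUnion_eq (m := μ.content) isSetAlgebra_openAlgebra.isSetRing (fun i _ => hf i) hd

/-- An invariant premeasure does not decrease under subequivalence: the pieces of the `F i` add up
to at least `∑ i, μ (F i)`, and their translates are disjoint inside the `V l`. Inner regularity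
then replaces the closed sets `F i` by the `O i`. -/
theorem sum_le_sum_of_prec [CompactSpace X] [ContinuousConstSMul G X] {n m : ℕ}
    {O : Fin n → Set X} {V : Fin m → Set X} (hO : ∀ i, IsOpen (O i)) (hV : ∀ l, IsOpen (V l))
    [T2Space X] (h : Prec G O V) : ∑ i, μ.val (O i) ≤ ∑ l, μ.val (V l) := by
  classical
  let C := {F : Fin n → Set X // ∀ i, IsClosed (F i) ∧ F i ⊆ O i}
  have hle : ∀ F : C, ∑ i, μ.val (F.1 i) ≤ ∑ l, μ.val (V l) := by
    rintro ⟨F, hF⟩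
    obtain ⟨J, hJ, π, U, s, k, hU, hc, hd, hs⟩ :=
      h.exists_family F (fun i => (hF i).1) (fun i => (hF i).2)
    have := Fintype.ofFinite J
    have hUa : ∀ j, U j ∈ openAlgebra X := fun j => mem_openAlgebra_of_isOpen (hU j)
    have hsUa : ∀ j, s j • U j ∈ openAlgebra X := fun j =>
      mem_openAlgebra_of_isOpen ((hU j).smul _)
    calc ∑ i, μ.val (F i) ≤ ∑ i, ∑ j with π j = i, μ.val (U j) := by
          refine Finset.sum_le_sum fun i _ => le_trans ?_ (μ.val_biUnion_le _ hUa)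
          refine μ.val_mono (mem_openAlgebra_of_isClosed (hF i).1)
            (isSetAlgebra_openAlgebra.biUnion_mem _ fun j _ => hUa j) fun x hx => ?_
          obtain ⟨j, hj, hxj⟩ := hc i x hx
          exact Set.mem_iUnion₂.2 ⟨j, by simpa using hj, hxj⟩
      _ = ∑ j, μ.val (U j) := Finset.sum_fiberwise _ _ _
      _ = ∑ j, μ.val (s j • U j) :=
          Finset.sum_congr rfl fun j _ => (μ.invariant _ _ (hUa j)).symm
      _ = ∑ l, ∑ j with k j = l, μ.val (s j • U j) := (Finset.sum_fiberwise _ _ _).symm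
      _ ≤ ∑ l, μ.val (V l) := by
          refine Finset.sum_le_sum fun l _ => ?_
          rw [← μ.val_biUnion_eq _ hsUa]
          · refine μ.val_mono (isSetAlgebra_openAlgebra.biUnion_mem _ fun j _ => hsUa j)
              (mem_openAlgebra_of_isOpen (hV l)) (Set.iUnion₂_subset fun j hj => ?_)
            rw [Finset.mem_filter] at hj
            exact hj.2 ▸ hs j
          · intro p hp q hq hpq
            simp only [Finset.coe_filter, Finset.mem_univ, true_and, Set.mem_ofPred_eq] at hp hq
            exact hd p q hpq (hp.trans hq.symm)
  have hsup : ∀ i, μ.val (O i) ≤ ⨆ F : C, μ.val (F.1 i) := by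
    intro i
    rw [μ.innerRegular _ (mem_openAlgebra_of_isOpen (hO i))]
    refine iSup₂_le fun F hF => ?_
    refine le_iSup_of_le (⟨Function.update (fun _ => ∅) i F, fun j => ?_⟩ : C) (by simp)
    rcases eq_or_ne j i with rfl | hj
    · simpa using ⟨hF.2.isClosed, hF.1⟩
    · simp [hj]
  refine (Finset.sum_le_sum fun i _ => hsup i).trans ?_
  rw [ENNReal.finsetSum_iSup]
  · exact iSup_le hle
  · intro F F'
    have hcl : ∀ i, IsClosed (F.1 i ∪ F'.1 i) := fun i => (F.2 i).1.union (F'.2 i).1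
    refine ⟨⟨fun i => F.1 i ∪ F'.1 i, fun i => ⟨hcl i, Set.union_subset (F.2 i).2 (F'.2 i).2⟩⟩,
      fun i => ⟨?_, ?_⟩⟩
    · exact μ.val_mono (mem_openAlgebra_of_isClosed (F.2 i).1)
        (mem_openAlgebra_of_isClosed (hcl i)) Set.subset_union_left
    · exact μ.val_mono (mem_openAlgebra_of_isClosed (F'.2 i).1)
        (mem_openAlgebra_of_isClosed (hcl i)) Set.subset_union_right

variable [CompactSpace X] [T2Space X] [ContinuousConstSMul G X]

/-- The additive function on `W X G` that sends the class of a sequence to the sum of the measures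
of its supports. -/
noncomputable def toW : W X G →+ ℝ≥0∞ where
  toFun := Quotient.lift (fun a : K X G => ∑ i, μ.val (a.supp i)) fun a b h =>
    le_antisymm (μ.sum_le_sum_of_prec a.isOpen_supp b.isOpen_supp h.1)
      (μ.sum_le_sum_of_prec b.isOpen_supp a.isOpen_supp h.2)
  map_zero' := by
    change ∑ i : Fin 1, μ.val ((K.zero : K X G).supp i) = 0
    rw [Fin.sum_univ_one]
    convert μ.empty
    ext x
    simp [K.supp, K.zero]
  map_add' x y := by
    induction x using W.ind with | h a =>
    induction y using W.ind with | h b =>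
    change ∑ i : Fin (a.len + b.len), μ.val ((a.concat b).supp i) =
      ∑ i, μ.val (a.supp i) + ∑ i, μ.val (b.supp i)
    rw [K.supp_concat, Fin.sum_univ_add]
    simp only [Fin.append_left, Fin.append_right]

theorem monotone_toW : Monotone μ.toW := by
  intro x y h
  induction x using W.ind with | h a =>
  induction y using W.ind with | h b =>
  exact μ.sum_le_sum_of_prec a.isOpen_supp b.isOpen_supp h

end InvPremeasure

theorem Prec.iUnion_subset [T1Space X] {n m : ℕ} {O : Fin n → Set X} {V : Fin m → Set X}
    (h : Prec G O V) : ⋃ i, O i ⊆ ⋃ g : G, g • ⋃ l, V l := by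
  classical
  intro x hx
  obtain ⟨i, hi⟩ := Set.mem_iUnion.1 hx
  obtain ⟨J, hJ, π, U, s, k, hU, hc, hd, hs⟩ :=
    h.exists_family (Function.update (fun _ => ∅) i {x})
    (fun j => by
      rcases eq_or_ne j i with rfl | hj
      · simp
      · simp [hj])
    (fun j => by
      rcases eq_or_ne j i with rfl | hj
      · simpa using hi
      · simp [hj])
  obtain ⟨j, -, hj⟩ := hc i x (by simp)
  refine Set.mem_iUnion.2 ⟨(s j)⁻¹, Set.mem_inv_smul_set_iff.2 ?_⟩
  exact Set.mem_iUnion.2 ⟨k j, hs j (Set.smul_mem_smul_set hj)⟩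

theorem iUnion_smul_subset_of_prec [T1Space X] {n m : ℕ} {O : Fin n → Set X} {V : Fin m → Set X}
    (h : Prec G O V) : ⋃ g : G, g • ⋃ i, O i ⊆ ⋃ g : G, g • ⋃ l, V l := by
  refine Set.iUnion_subset fun g => ?_
  refine (Set.smul_set_mono h.iUnion_subset).trans ?_
  rw [Set.smul_set_iUnion]
  refine Set.iUnion_subset fun g' => ?_
  rw [← mul_smul]
  exact Set.subset_iUnion (fun g : G => g • ⋃ l, V l) (g * g')

variable [CompactSpace X] [T2Space X] [ContinuousConstSMul G X]

/-- The invariant open set generated by the supports of a sequence, as a function of its class. -/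
def saturation : W X G → Set X :=
  Quotient.lift (fun a : K X G => ⋃ g : G, g • ⋃ i, a.supp i) fun _ _ h =>
    (iUnion_smul_subset_of_prec h.1).antisymm (iUnion_smul_subset_of_prec h.2)

theorem saturation_mk (a : K X G) : saturation (W.mk a) = ⋃ g : G, g • ⋃ i, a.supp i := rfl

theorem saturation_mono {x y : W X G} (h : x ≤ y) : saturation x ⊆ saturation y := by
  induction x using W.ind with | h a =>
  induction y using W.ind with | h b =>
  exact iUnion_smul_subset_of_prec h

theorem saturation_add (x y : W X G) : saturation (x + y) = saturation x ∪ saturation y := by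
  induction x using W.ind with | h a =>
  induction y using W.ind with | h b =>
  simp only [W.mk_add_mk, saturation_mk, K.iUnion_supp_concat, Set.smul_set_union,
    Set.iUnion_union_distrib]

theorem saturation_nsmul_subset (n : ℕ) (x : W X G) : saturation (n • x) ⊆ saturation x := by
  induction n with
  | zero =>
    rw [zero_nsmul]
    exact saturation_mono (W.nonneg x)
  | succ n ih =>
    rw [succ_nsmul, saturation_add]
    exact Set.union_subset ih subset_rfl

end Functional

/-! ### Comparison -/

section Comparison

open TopologicalSpace MeasureTheory

variable {X G : Type*} [TopologicalSpace X] [CompactSpace X] [MetrizableSpace X] [Group G]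
  [MulAction G X] [ContinuousConstSMul G X]

/-- The class in `W X G` of a nonempty sequence of open sets is the sum of the classes of its
terms, and subequivalence of sequences is the order on the classes. -/
theorem prec_iff_sum_le_sum {n m : ℕ} (hn : 0 < n) (hm : 0 < m) (O : Fin n → Opens X)
    (V : Fin m → Opens X) :
    Prec G (fun i => (O i : Set X)) (fun l => (V l : Set X)) ↔
      ∑ i, openClass G (O i) ≤ ∑ l, openClass G (V l) := by
  choose f hf using fun i => exists_support_eq (O i).isOpen
  choose g hg using fun l => exists_support_eq (V l).isOpen
  let a : K X G := ⟨n, hn, f⟩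
  let b : K X G := ⟨m, hm, g⟩
  obtain rfl : (fun i => ⟨a.supp i, a.isOpen_supp i⟩) = O := funext fun i => Opens.ext (hf i)
  obtain rfl : (fun l => ⟨b.supp l, b.isOpen_supp l⟩) = V := funext fun l => Opens.ext (hg l)
  change a ≤ b ↔ ∑ i : Fin a.len, _ ≤ ∑ l : Fin b.len, _
  rw [← W.mk_eq_sum, ← W.mk_eq_sum, W.mk_le_mk]

/-- Compactness: if the closure of `U` lies in the saturation of `V`, then finitely many translates
of `V` cover `U`. -/
theorem exists_openClass_le_nsmul {U V : Opens X}
    (h : closure (U : Set X) ⊆ ⋃ g : G, g • (V : Set X)) :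
    ∃ m : ℕ, openClass G U ≤ m • openClass G V := by
  obtain ⟨t, ht⟩ := isClosed_closure.isCompact.elim_finite_subcover
    (fun g : G => g • (V : Set X)) (fun g => V.isOpen.smul g) h
  refine ⟨Fintype.card t, ?_⟩
  have := openClass_le_sum (G := G) (O := U) (V := fun _ : t => V) (s := fun g => g.1)
    (subset_closure.trans (ht.trans
      (Set.iUnion_subtype (· ∈ t) fun g => g.1 • (V : Set X)).symm.subset))
  simpa using this

theorem regularization_const_mul (c : ℝ≥0∞) (D : W X G →+ ℝ≥0∞) (O : Set X) :
    regularization ((AddMonoidHom.mulLeft c).comp D) O = c * regularization D O := by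
  simp [regularization, ENNReal.mul_iSup]

/-- The measure of an open set in the saturation of a null open set is zero. -/
theorem regularization_eq_zero_of_subset [Countable G] {D : W X G →+ ℝ≥0∞} (hD : Monotone D)
    {ι : Type*} [Finite ι] {A : Set X} {B : ι → Set X} (hB : ∀ j, IsOpen (B j))
    (h0 : ∀ j, regularization D (B j) = 0) (h : A ⊆ ⋃ g : G, g • ⋃ j, B j) :
    regularization D A = 0 := by
  have hz : outerMeasure D (⋃ g : G, g • ⋃ j, B j) = 0 := by
    refine measure_iUnion_null fun g => ?_
    rw [outerMeasure_smul hD]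
    exact measure_iUnion_null fun j => (outerMeasure_of_isOpen hD (hB j)).trans (h0 j)
  refine le_antisymm ((regularization_mono h).trans ?_) zero_le
  rw [← hz, outerMeasure_of_isOpen hD
    (isOpen_iUnion fun g => (isOpen_iUnion hB).smul g)]

/-- The comparison property with a little room: the `U i` are subequivalent to the `B j` if their
closures lie in sets `A i` that satisfy the measure condition. -/
theorem AlmostUnperforated.sum_le_sum [Countable G] (hW : AlmostUnperforated (W X G))
    {ι κ : Type*} [Fintype ι] [Fintype κ] {A : ι → Set X} {U : ι → Opens X} {B : κ → Opens X}
    (hA : ∀ i, IsOpen (A i)) (hUA : ∀ i, closure (U i : Set X) ⊆ A i)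
    (hAB : ⋃ i, A i ⊆ ⋃ g : G, g • ⋃ j, (B j : Set X))
    (hμ : ∀ μ : InvPremeasure X G, ∑ j, μ.val (B j) = 1 →
      ∑ i, μ.val (A i) < ∑ j, μ.val (B j)) :
    ∑ i, openClass G (U i) ≤ ∑ j, openClass G (B j) := by
  have hsub : ∀ i, A i ⊆ ⋃ g : G, g • ⋃ j, (B j : Set X) := fun i =>
    (Set.subset_iUnion A i).trans hAB
  obtain ⟨m, hm⟩ : ∃ m : ℕ, ∑ i, openClass G (U i) ≤ m • ∑ j, openClass G (B j) := by
    have hB : openClass G (⨆ j, B j) ≤ ∑ j, openClass G (B j) :=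
      openClass_le_sum (s := fun _ => 1) (by simp)
    choose m hm using fun i => exists_openClass_le_nsmul (G := G) (U := U i) (V := ⨆ j, B j)
      (by rw [Opens.coe_iSup]; exact (hUA i).trans (hsub i))
    refine ⟨∑ i, m i, ?_⟩
    rw [Finset.sum_smul]
    exact Finset.sum_le_sum fun i _ => (hm i).trans (nsmul_le_nsmul_right hB _)
  by_contra hxy
  obtain ⟨D, hD, hDy, hDx⟩ := hW.exists_additive W.nonneg hm hxy
  rw [map_sum] at hDx hDy
  have hα : 1 ≤ ∑ i, regularization D (A i) :=
    hDx.trans (Finset.sum_le_sum fun i _ => le_regularization (hUA i))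
  set β := ∑ j, regularization D (B j : Set X) with hβ
  have hβ1 : β ≤ 1 := (Finset.sum_le_sum fun j _ => regularization_le hD (B j)).trans hDy
  rcases eq_or_ne β 0 with h0 | h0
  · -- The `B j` are null, hence so are the `A i`, as `G` is countable.
    have hz : ∑ i, regularization D (A i) = 0 := Finset.sum_eq_zero fun i _ =>
      regularization_eq_zero_of_subset hD (fun j => (B j).isOpen)
        (fun j => Finset.sum_eq_zero_iff.1 h0 j (Finset.mem_univ j)) (hsub i)
    rw [hz] at hα
    exact absurd hα (by simp)
  · -- Regularizing may have decreased the value at `B`, so the premeasure is normalized again.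
    have hD' : Monotone ((AddMonoidHom.mulLeft β⁻¹).comp D) := fun a b hab =>
      mul_le_mul_right (hD hab) _
    have hvalB : ∑ j, (invPremeasure hD').val (B j) = 1 := by
      simp only [fun j => invPremeasure_val_of_isOpen hD' (B j).isOpen, regularization_const_mul]
      rw [← Finset.mul_sum, ← hβ]
      exact ENNReal.inv_mul_cancel h0 (hβ1.trans_lt ENNReal.one_lt_top).ne
    have hvalA : ∑ i, (invPremeasure hD').val (A i) = β⁻¹ * ∑ i, regularization D (A i) := by
      simp only [fun i => invPremeasure_val_of_isOpen hD' (hA i), regularization_const_mul]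
      rw [← Finset.mul_sum]
    have h := hμ (invPremeasure hD') hvalB
    rw [hvalB, hvalA] at h
    exact h.not_ge (one_le_mul (ENNReal.one_le_inv.2 hβ1) hα)

theorem InvPremeasure.toW_lt_one (μ : InvPremeasure X G) {x y : W X G} {n : ℕ}
    (h : (n + 1) • x ≤ n • y) (hy : μ.toW y = 1) : μ.toW x < 1 := by
  have h' := μ.monotone_toW h
  rw [map_nsmul, map_nsmul, hy] at h'
  by_contra hx
  have h1 : (n + 1) • (1 : ℝ≥0∞) ≤ n • 1 := (nsmul_le_nsmul_right (not_lt.1 hx) _).trans h'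
  rw [nsmul_one, nsmul_one, Nat.cast_le] at h1
  omega

end Comparison

end GenTypeSemigroup

open GenTypeSemigroup in
theorem theoremA (X G : Type*) [TopologicalSpace X] [CompactSpace X]
    [TopologicalSpace.MetrizableSpace X] [Group G] [Countable G] [MulAction G X]
    [ContinuousConstSMul G X] :
    GenTypeSemigroup.AlmostUnperforated (GenTypeSemigroup.W X G) ↔
      ∀ (k l : ℕ) (_ : 0 < k) (_ : 0 < l) (A : Fin k → Set X) (B : Fin l → Set X),
        (∀ i, IsOpen (A i)) → (∀ j, IsOpen (B j)) →
        (⋃ i, A i) ⊆ (⋃ g : G, g • ⋃ j, B j) →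
        (∀ μ : GenTypeSemigroup.InvPremeasure X G, ∑ j, μ.val (B j) = 1 →
          ∑ i, μ.val (A i) < ∑ j, μ.val (B j)) →
        GenTypeSemigroup.Prec G A B := by
  constructor
  · intro hW k l hk hl A B hA hB hAB hμ F hF hFA
    choose U hU hFU hUA using fun i => normal_exists_closure_subset (hF i) (hA i) (hFA i)
    have h := hW.sum_le_sum (U := fun i => ⟨U i, hU i⟩) (B := fun j => ⟨B j, hB j⟩) hA hUA hAB hμ
    exact (prec_iff_sum_le_sum hk hl _ _).2 h F hF hFU
  · rintro h x y ⟨n, -, hn⟩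
    have hsat : saturation x ⊆ saturation y :=
      calc saturation x ⊆ saturation ((n + 1) • x) := by
            rw [succ_nsmul, saturation_add]
            exact Set.subset_union_right
        _ ⊆ saturation (n • y) := saturation_mono hn
        _ ⊆ saturation y := saturation_nsmul_subset n y
    induction x using W.ind with | h a =>
    induction y using W.ind with | h b =>
    refine W.mk_le_mk.2 (h _ _ a.len_pos b.len_pos a.supp b.supp a.isOpen_supp b.isOpen_supp ?_ ?_)
    · rw [saturation_mk, saturation_mk] at hsat
      refine Set.Subset.trans ?_ hsat
      simpa only [one_smul] using Set.subset_iUnion (fun g : G => g • ⋃ i, a.supp i) 1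
    · intro μ hμ
      rw [hμ]
      exact μ.toW_lt_one hn hμ
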